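/- Let $(G,+)$ be a countable discrete abelian group with dual group $\widehat G$, equipped with its Haar measure of total mass $1$, and let $x\mapsto\widehat x$ be the Fourier transform $\ell^2(G)\to L^2(\widehat G)$, $\widehat x(\xi)=\sum_{g\in G}x(g)\overline{\langle g,\xi\rangle}$ (convergence in $L^2(\widehat G)$). Let $g\mapsto U(g)$ be a unitary representation of $G$ on a separable complex Hilbert space $\mathcal H$, and let $\Phi=\{\varphi_1,\dots,\varphi_N\}\subset\mathcal H$ be such that $\{U(g)\varphi_n\}_{g\in G;\,n=1,\dots,N}$ is a Riesz sequence in $\mathcal H$, i.e. a Riesz basis of its closed linear span $\mathcal V_\Phi$, so that every $f\in\mathcal V_\Phi$ is $f=\sum_{n=1}^N\sum_{g\in G}x_n(g)U(g)\varphi_n$ for unique $x_1,\dots,x_N\in\ell^2(G)$. Let $A=[a_{m,n}]$ be an $N\times N$ matrix with entries in $\ell^2(G)$ and define the samples of such an $f$ by $$\mathcal L_m f(g)=\sum_{n=1}^N (a_{m,n}*x_n)(g)=\sum_{n=1}^N\sum_{g'\in G}a_{m,n}(g-g')\,x_n(g'),\qquad g\in G,\ m=1,\dots,N.$$ Assume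 that all entries of the transfer matrix $\widehat A=[\widehat a_{m,n}]$ belong to $L^\infty(\widehat G)$. Then the following statements are equivalent: 1. $\operatorname{ess\,inf}_{\xi\in\widehat G}\,|\det\widehat A(\xi)|>0$. 2. There exist unique elements $S_1,\dots,S_N\in\mathcal V_\Phi$ such that $\{U(g)S_n\}_{g\in G;\,n=1,\dots,N}$ is a Riesz basis of $\mathcal V_\Phi$ and the sampling formula $$f=\sum_{n=1}^N\sum_{g\in G}\mathcal L_n f(g)\,U(g)S_n\quad\text{in }\mathcal H$$ holds, with unconditional convergence, for every $f\in\mathcal V_\Phi$. Moreover, whenever $S_1,\dots,S_N\in\mathcal V_\Phi$ are as in 2, the interpolation property $\mathcal L_nS_{n'}(g)=\delta_{n,n'}\delta_{g,0}$ holds for all $g\in G$ and $n,n'=1,\dots,N$. -/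

import Mathlib

open MeasureTheory
open scoped ENNReal ComplexConjugate

namespace USampling

noncomputable section

/-- `ℓ²(ι)`: square-summable complex families on `ι`. -/
abbrev ell2 (ι : Type*) : Type _ := lp (fun _ : ι => ℂ) 2

/-! ### The dual group and the Fourier transform -/

section Fourier

variable (G : Type*) [AddCommGroup G] [TopologicalSpace G]

/-- The dual group: characters of the additive group `G`, with the compact-open topology. -/
abbrev Dual : Type _ := PontryaginDual (Multiplicative G)

instance dualMeasurableSpace : MeasurableSpace (Dual G) := borel (Dual G)

instance dualBorelSpace : BorelSpace (Dual G) := ⟨rfl⟩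

variable [DiscreteTopology G]

/-- The Haar measure on the compact dual group, normalized to have total mass one. -/
def dualHaar : Measure (Dual G) := Measure.haarMeasure ⊤

instance dualHaar_isHaarMeasure : (dualHaar G).IsHaarMeasure := by
  unfold dualHaar; infer_instance

instance dualHaar_isProbabilityMeasure : IsProbabilityMeasure (dualHaar G) :=
  ⟨by
    have h := Measure.haarMeasure_self (K₀ := (⊤ : TopologicalSpace.PositiveCompacts (Dual G)))
    simpa [dualHaar] using h⟩

variable {G}

/-- The continuous function `ξ ↦ conj ⟨g, ξ⟩` on the dual group. -/
def conjChar (g : G) : C(Dual G, ℂ) where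
  toFun ξ := conj ((ξ (Multiplicative.ofAdd g) : Circle) : ℂ)
  continuous_toFun := by
    have h : Continuous fun ξ : Dual G => ξ (Multiplicative.ofAdd g) :=
      ContinuousEvalConst.continuous_eval_const
        (F := Multiplicative G →ₜ* Circle) (Multiplicative.ofAdd g)
    exact Complex.continuous_conj.comp (continuous_subtype_val.comp h)

/-- `conjChar g` as an element of `L²` of the dual group. -/
def conjCharL2 (g : G) : Lp ℂ 2 (dualHaar G) :=
  ContinuousMap.toLp 2 (dualHaar G) ℂ (conjChar g)

/-- The Fourier transform `ℓ²(G) → L²(Ĝ)`, `x ↦ ∑_g x(g) conj ⟨g, ξ⟩`, the series converging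
unconditionally in `L²(Ĝ)` (see `hasSum_fourier`). -/
def fourier (x : ell2 G) : Lp ℂ 2 (dualHaar G) := ∑' g : G, x g • conjCharL2 g

lemma exists_char_ne_one {g : G} (hg : g ≠ 0) :
    ∃ η : Dual G, η (Multiplicative.ofAdd g) ≠ 1 := by
  obtain ⟨c, hc⟩ := CharacterModule.exists_character_apply_ne_zero_of_ne_zero hg
  let ψ : ℚ →+ Additive Circle :=
    { toFun := fun q => Additive.ofMul (Circle.exp (2 * Real.pi * (q : ℝ)))
      map_zero' := by simp
      map_add' := fun p q => by
        simp [mul_add, Circle.exp_add] }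
  have hψ : AddSubgroup.zmultiples (1 : ℚ) ≤ ψ.ker := by
    rw [AddSubgroup.zmultiples_le]
    change Circle.exp (2 * Real.pi * ((1 : ℚ) : ℝ)) = 1
    simp
  let Ψ : AddCircle (1 : ℚ) →+ Additive Circle := QuotientAddGroup.lift _ ψ hψ
  have hΨ : ∀ t, Ψ t = 0 → t = 0 := by
    intro t
    induction t using QuotientAddGroup.induction_on with
    | H q =>
      intro h
      have h1 : Circle.exp (2 * Real.pi * (q : ℝ)) = 1 := h
      obtain ⟨n, hn⟩ := Circle.exp_eq_one.1 h1
      have hq : (q : ℝ) = n := by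
        have := Real.pi_pos
        have h2 : (2 * Real.pi) * ((q : ℝ) - n) = 0 := by linarith
        rcases mul_eq_zero.1 h2 with h3 | h3 <;> linarith
      have hq' : q = n := by exact_mod_cast hq
      rw [QuotientAddGroup.eq_zero_iff, AddSubgroup.mem_zmultiples_iff]
      exact ⟨n, by simp [hq']⟩
  let c' : G →+ AddCircle (1 : ℚ) := c
  let η : Dual G :=
    ({ toMonoidHom := AddMonoidHom.toMultiplicativeLeft (Ψ.comp c')
       continuous_toFun := continuous_of_discreteTopology } : Multiplicative G →ₜ* Circle)
  exact ⟨η, fun h => hc (hΨ _ h)⟩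

lemma orthonormal_conjCharL2 : Orthonormal ℂ (conjCharL2 : G → Lp ℂ 2 (dualHaar G)) := by
  classical
  rw [orthonormal_iff_ite]
  intro i j
  unfold conjCharL2
  rw [ContinuousMap.inner_toLp (dualHaar G) (conjChar i) (conjChar j)]
  have key : ∀ ξ : Dual G, conjChar j ξ * conj (conjChar i ξ)
      = ((ξ (Multiplicative.ofAdd (i - j)) : Circle) : ℂ) := by
    intro ξ
    simp [conjChar, ofAdd_sub, div_eq_mul_inv, mul_comm, ← Circle.coe_inv_eq_conj]
  simp_rw [key]
  split_ifs with h
  · simp [h]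
  obtain ⟨η, hη⟩ := exists_char_ne_one (sub_ne_zero.2 h)
  have h1 := integral_mul_left_eq_self (μ := dualHaar G)
    (fun ξ : Dual G => ((ξ (Multiplicative.ofAdd (i - j)) : Circle) : ℂ)) η
  have h2 : ∀ ξ : Dual G, (((η * ξ) (Multiplicative.ofAdd (i - j)) : Circle) : ℂ)
      = ((η (Multiplicative.ofAdd (i - j)) : Circle) : ℂ)
        * ((ξ (Multiplicative.ofAdd (i - j)) : Circle) : ℂ) := fun ξ => rfl
  simp_rw [h2, integral_const_mul] at h1
  by_contra h0
  exact hη (Circle.ext (by simpa using mul_right_cancel₀ h0 (h1.trans (one_mul _).symm)))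

lemma hasSum_fourier (x : ell2 G) :
    HasSum (fun g : G => x g • conjCharL2 g) (fourier x) := by
  have h := (orthonormal_conjCharL2 (G := G)).orthogonalFamily.hasSum_linearIsometry x
  have h' : HasSum (fun g : G => x g • conjCharL2 g) _ := h
  exact h'.summable.hasSum

/-- The transfer matrix `Â(ξ)`, defined for almost every `ξ`. -/
def transferMatrix {M N : ℕ} (A : Matrix (Fin M) (Fin N) (ell2 G)) (ξ : Dual G) :
    Matrix (Fin M) (Fin N) ℂ :=
  Matrix.of fun m n => fourier (A m n) ξ

end Fourier

/-! ### Riesz bases -/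

section Riesz

variable {ι H : Type*} [NormedAddCommGroup H] [InnerProductSpace ℂ H]

open Classical in
/-- `f` is a Riesz basis of the subspace `V` if it is the image of the standard orthonormal basis
of `ℓ²(ι)` under a bounded linear bijection, with bounded inverse, from `ℓ²(ι)` onto `V`. -/
def IsRieszBasis (f : ι → H) (V : Submodule ℂ H) : Prop :=
  ∃ T : ell2 ι ≃L[ℂ] V, ∀ i, (T (lp.single 2 i 1) : H) = f i

/-- The closed linear span of a family. -/
def closedSpan (f : ι → H) : Submodule ℂ H := (Submodule.span ℂ (Set.range f)).topologicalClosure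

/-- `f` is a Riesz sequence if it is a Riesz basis of its closed linear span. -/
def IsRieszSequence (f : ι → H) : Prop := IsRieszBasis f (closedSpan f)

/-- The isomorphism from `ℓ²(ι)` onto the closed span of a Riesz sequence `f` that sends the
standard basis to `f`. -/
def IsRieszSequence.synthesis {f : ι → H} (hf : IsRieszSequence f) :
    ell2 ι ≃L[ℂ] closedSpan f :=
  hf.choose

end Riesz

/-! ### Sampling in `U`-invariant subspaces -/

section Sampling

variable {G H : Type*} [AddCommGroup G] [NormedAddCommGroup H] [InnerProductSpace ℂ H]

/-- The family `{U(g) φ_n}` indexed by `(g, n)`. -/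
def orbit (U : Multiplicative G →* (H ≃ₗᵢ[ℂ] H)) {N : ℕ} (φ : Fin N → H) : G × Fin N → H :=
  fun p => U (Multiplicative.ofAdd p.1) (φ p.2)

/-- The subspace `V_Φ`, the closed linear span of `{U(g) φ_n}`. -/
abbrev VΦ (U : Multiplicative G →* (H ≃ₗᵢ[ℂ] H)) {N : ℕ} (φ : Fin N → H) : Submodule ℂ H :=
  closedSpan (orbit U φ)

/-- Convolution on `G`. -/
def conv (a x : G → ℂ) (g : G) : ℂ := ∑' g' : G, a (g - g') * x g'

/-- The sample `L_m f(g) = ∑_n (a_{m,n} * x_n)(g)` of `f = ∑_n ∑_g x_n(g) U(g) φ_n` in `V_Φ`,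
where `{U(g) φ_n}` is a Riesz sequence. -/
def sample {U : Multiplicative G →* (H ≃ₗᵢ[ℂ] H)} {M N : ℕ} {φ : Fin N → H}
    (hφ : IsRieszSequence (orbit U φ)) (A : Matrix (Fin M) (Fin N) (ell2 G)) (m : Fin M)
    (f : VΦ U φ) (g : G) : ℂ :=
  ∑ n : Fin N, conv (A m n) (fun g' => hφ.synthesis.symm f (g', n)) g

/-- The sampling formula `f = ∑_m ∑_g L_m f(g) U(g) S_m`, with unconditional convergence in `H`,
for every `f` in `V_Φ`. -/
def SamplingFormula {U : Multiplicative G →* (H ≃ₗᵢ[ℂ] H)} {M N : ℕ} {φ : Fin N → H}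
    (hφ : IsRieszSequence (orbit U φ)) (A : Matrix (Fin M) (Fin N) (ell2 G))
    (S : Fin M → VΦ U φ) : Prop :=
  ∀ f : VΦ U φ, HasSum
    (fun p : G × Fin M => sample hφ A p.2 f p.1 • U (Multiplicative.ofAdd p.1) (S p.2 : H))
    (f : H)

end Sampling

end

end USampling

/-!
Let `T` be the isomorphism from `ℓ²(G × Fin N)` onto `V_Φ` that sends the standard basis to
`{U(g) φ_n}`. In these coordinates taking samples is the convolution operator `x ↦ A * x`, which
the Fourier transform turns into multiplication by `Â(ξ)` on `L²(Ĝ)^N` (`convOp_apply`). Since the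
entries of `Â` are bounded, this is a bounded operator `Λ` on `ℓ²(G × Fin N)`.

If `{U(g) S_n}` is a Riesz basis of `V_Φ`, with isomorphism `R`, the sampling formula says exactly
that `R Λ = T` (`samplingFormula_iff`). So statement 2 forces `Λ = R⁻¹ T` to be invertible.
Conversely, if `Λ` is invertible then `R = T Λ⁻¹` is the only candidate, with `S_n = R e_(0,n)`;
it sends the standard basis to an orbit of `U` because `T` and `Λ` commute with translations
(`synthesis_translate`, `convOp_translate`). The interpolation property is
`Λ T⁻¹ S_n = R⁻¹ S_n = e_(0,n)`.

It remains to see that multiplication by a bounded matrix function `M` is bijective on `L²` if and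
only if `|det M|` is essentially bounded below. If it is, `M⁻¹` is bounded by Cramer's rule
(`bijective_mulMatrix_of_det`). If multiplication by `M` is bijective, the solutions of
`M F_j = e_j` are the columns of `M⁻¹`; they are essentially bounded, since the norm of the inverse
operator controls every cut-off `1_E F_j`, and so `det M⁻¹` is bounded
(`essInf_det_pos_of_bijective`).
-/

namespace USampling

noncomputable section

/-! ### Square-summable families -/

section Ell2

variable {ι κ : Type*}

lemma memℓp_two_iff {x : ι → ℂ} : Memℓp x 2 ↔ Summable fun i => ‖x i‖ ^ 2 := by
  rw [memℓp_gen_iff (by norm_num)]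
  simp

lemma continuous_ell2_apply (i : ι) : Continuous fun x : ell2 ι => x i :=
  (lp.evalCLM ℂ (fun _ : ι => ℂ) i (p := 2)).continuous

/-- By the closed graph theorem, a linear map into `ℓ²` is bounded as soon as its coordinates
are. -/
lemma continuous_of_continuous_coord {E : Type*} [NormedAddCommGroup E] [NormedSpace ℂ E]
    [CompleteSpace E] (L : E →ₗ[ℂ] ell2 ι) (h : ∀ i, Continuous fun x => L x i) :
    Continuous L := by
  refine L.continuous_of_seq_closed_graph fun u x y hu hy => ?_
  refine lp.ext (funext fun i => ?_)
  exact tendsto_nhds_unique (((continuous_ell2_apply i).tendsto y).comp hy)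
    (((h i).tendsto x).comp hu)

/-- Relabelling of the indices, `x ↦ x ∘ e`. -/
def reindex (e : ι ≃ κ) : ell2 κ →L[ℂ] ell2 ι where
  toFun x := ⟨fun i => x (e i), memℓp_two_iff.2
    ((e.summable_iff (f := fun k => ‖x k‖ ^ 2)).2 (memℓp_two_iff.1 (lp.memℓp x)))⟩
  map_add' _ _ := rfl
  map_smul' _ _ := rfl
  cont := continuous_of_continuous_coord
    { toFun := _, map_add' := fun _ _ => rfl, map_smul' := fun _ _ => rfl }
    fun i => continuous_ell2_apply (e i)

@[simp] lemma reindex_apply (e : ι ≃ κ) (x : ell2 κ) (i : ι) : reindex e x i = x (e i) := rfl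

open Classical in
/-- The standard basis vector of `ℓ²(ι)` at `i`. -/
def stdVec (i : ι) : ell2 ι := lp.single 2 i 1

open Classical in
lemma stdVec_apply (i j : ι) : stdVec i j = if j = i then 1 else 0 := by
  simp [stdVec, lp.single_apply, Pi.single_apply]

lemma reindex_stdVec (e : ι ≃ κ) (i : ι) : reindex e (stdVec (e i)) = stdVec i := by
  refine lp.ext (funext fun j => ?_)
  rw [reindex_apply, stdVec_apply, stdVec_apply]
  by_cases h : j = i
  · rw [if_pos h, if_pos (congrArg e h)]
  · rw [if_neg h, if_neg fun h' => h (e.injective h')]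

/-- The identification of a family indexed by `ι × κ`, with `κ` finite, with the `κ`-tuple of its
slices. -/
def slices [Fintype κ] : ell2 (ι × κ) ≃L[ℂ] (κ → ell2 ι) :=
  LinearEquiv.toContinuousLinearEquivOfContinuous
    { toFun := fun x k => ⟨fun i => x (i, k), memℓp_two_iff.2
        ((memℓp_two_iff.1 (lp.memℓp x)).comp_injective (i := fun i => (i, k))
          fun _ _ h => congrArg Prod.fst h)⟩
      invFun := fun y => ⟨fun p => y p.2 p.1, memℓp_two_iff.2 <|
        (summable_prod_of_nonneg fun _ => by positivity).2 ⟨fun _ => Summable.of_finite, by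
          simp only [tsum_fintype]
          exact summable_sum fun k _ => memℓp_two_iff.1 (lp.memℓp (y k))⟩⟩
      map_add' := fun _ _ => rfl
      map_smul' := fun _ _ => rfl
      left_inv := fun _ => rfl
      right_inv := fun _ => rfl }
    (continuous_pi fun k => continuous_of_continuous_coord
      { toFun := fun x => _, map_add' := fun _ _ => rfl, map_smul' := fun _ _ => rfl }
      fun i => continuous_ell2_apply (i, k))

@[simp] lemma slices_apply [Fintype κ] (x : ell2 (ι × κ)) (k : κ) (i : ι) :
    slices x k i = x (i, k) := rfl

@[simp] lemma slices_symm_apply [Fintype κ] (y : κ → ell2 ι) (p : ι × κ) :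
    slices.symm y p = y p.2 p.1 := rfl

lemma clm_ext_stdVec {E : Type*} [NormedAddCommGroup E] [NormedSpace ℂ E]
    {L M : ell2 ι →L[ℂ] E} (h : ∀ i, L (stdVec i) = M (stdVec i)) : L = M := by
  classical
  refine lp.ext_continuousLinearMap (by norm_num) fun i => ?_
  ext
  simpa [stdVec] using h i

lemma hasSum_clm_stdVec {E : Type*} [NormedAddCommGroup E] [NormedSpace ℂ E]
    (L : ell2 ι →L[ℂ] E) (x : ell2 ι) :
    HasSum (fun i => x i • L (stdVec i)) (L x) := by
  classical
  have h := L.hasSum (lp.hasSum_single (by norm_num) x)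
  refine h.congr_fun fun i => ?_
  rw [← map_smul, stdVec, ← lp.single_smul, smul_eq_mul, mul_one]

end Ell2

/-! ### Multiplication by a bounded matrix function -/

section Multiplication

variable {α ι : Type*} [Fintype ι] [DecidableEq ι] {mα : MeasurableSpace α} {μ : Measure α}

/-- Multiplication of vectors of `L²` functions by a matrix of `L^∞` functions. The vectors carry
the supremum of the `L²` norms of their components. -/
def mulMatrix (M : Matrix ι ι (Lp ℂ ∞ μ)) : (ι → Lp ℂ 2 μ) →L[ℂ] (ι → Lp ℂ 2 μ) :=
  ContinuousLinearMap.pi fun i => ∑ j,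
    ((ContinuousLinearMap.mul ℂ ℂ).holderL μ ∞ 2 2 (M i j)).comp (ContinuousLinearMap.proj j)

omit [DecidableEq ι] in
lemma coeFn_mulMatrix (M : Matrix ι ι (Lp ℂ ∞ μ)) (F : ι → Lp ℂ 2 μ) :
    ∀ᵐ ξ ∂μ, (fun i => mulMatrix M F i ξ) = (M.map fun f => f ξ).mulVec fun j => F j ξ := by
  have h1 : ∀ i j, ∀ᵐ ξ ∂μ, (ContinuousLinearMap.mul ℂ ℂ).holder 2 (M i j) (F j) ξ
      = M i j ξ * F j ξ := fun i j => (ContinuousLinearMap.mul ℂ ℂ).coeFn_holder _ _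
  have h2 : ∀ i, ∀ᵐ ξ ∂μ, mulMatrix M F i ξ
      = ∑ j, (ContinuousLinearMap.mul ℂ ℂ).holder 2 (M i j) (F j) ξ := by
    intro i
    have : mulMatrix M F i = ∑ j, (ContinuousLinearMap.mul ℂ ℂ).holder 2 (M i j) (F j) := by
      simp [mulMatrix]
    rw [this]
    exact Lp.coeFn_fun_finsetSum _ _
  filter_upwards [ae_all_iff.2 fun i => ae_all_iff.2 (h1 i), ae_all_iff.2 h2] with ξ h h'
  ext i
  simp [h', h, Matrix.mulVec, dotProduct]

lemma mulMatrix_mulMatrix_of_ae {M B : Matrix ι ι (Lp ℂ ∞ μ)}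
    (h : ∀ᵐ ξ ∂μ, (M.map fun f => f ξ) * (B.map fun f => f ξ) = 1) (F : ι → Lp ℂ 2 μ) :
    mulMatrix M (mulMatrix B F) = F := by
  funext i
  refine Lp.ext ?_
  filter_upwards [h, coeFn_mulMatrix M (mulMatrix B F), coeFn_mulMatrix B F] with ξ h1 h2 h3
  rw [h3, Matrix.mulVec_mulVec, h1, Matrix.one_mulVec] at h2
  exact congrFun h2 i

lemma norm_det_le (P : Matrix ι ι ℂ) {K : ℝ} (h : ∀ i j, ‖P i j‖ ≤ K) :
    ‖P.det‖ ≤ (Fintype.card ι).factorial * K ^ Fintype.card ι := by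
  have := Matrix.det_le (abv := NormedField.toAbsoluteValue ℂ) h
  rwa [nsmul_eq_mul] at this

lemma ae_norm_le_norm_top (f : Lp ℂ ∞ μ) : ∀ᵐ ξ ∂μ, ‖f ξ‖ ≤ ‖f‖ := by
  filter_upwards [enorm_ae_le_eLpNormEssSup f μ] with ξ h
  rw [← eLpNorm_exponent_top, ← Lp.enorm_def] at h
  exact enorm_le_iff_norm_le.1 h

/-- If `|det M|` is bounded below, then `M⁻¹ = (det M)⁻¹ adj M` is again a bounded matrix
function. -/
lemma bijective_mulMatrix_of_det (M : Matrix ι ι (Lp ℂ ∞ μ))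
    (h : 0 < essInf (fun ξ => ‖(M.map fun f => f ξ).det‖ₑ) μ) :
    Function.Bijective (mulMatrix M) := by
  obtain ⟨c, hc0, hc⟩ : ∃ c : ℝ, 0 < c ∧ ∀ᵐ ξ ∂μ, c ≤ ‖(M.map fun f => f ξ).det‖ := by
    obtain ⟨c, hc0, hc⟩ := ENNReal.lt_iff_exists_nnreal_btwn.1 h
    refine ⟨c, by exact_mod_cast hc0, ?_⟩
    filter_upwards [ae_essInf_le (f := fun ξ => ‖(M.map fun f => f ξ).det‖ₑ) (μ := μ)] with ξ hξ
    have : (c : ℝ≥0∞) ≤ ‖(M.map fun f => f ξ).det‖ₑ := hc.le.trans hξ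
    exact_mod_cast this
  -- The bound has to be at least `1` because the entries of the adjugate are determinants of
  -- matrices in which a row is replaced by a unit vector.
  obtain ⟨K, hK1, hK⟩ : ∃ K : ℝ, 1 ≤ K ∧ ∀ᵐ ξ ∂μ, ∀ i j, ‖M i j ξ‖ ≤ K := by
    refine ⟨1 + ∑ i, ∑ j, ‖M i j‖, by
      have : 0 ≤ ∑ i, ∑ j, ‖M i j‖ := by positivity
      linarith, ae_all_iff.2 fun i => ae_all_iff.2 fun j => ?_⟩
    have h1 : ‖M i j‖ ≤ ∑ j, ‖M i j‖ :=
      Finset.single_le_sum (f := fun j => ‖M i j‖) (fun _ _ => norm_nonneg _) (Finset.mem_univ j)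
    have h2 : ∑ j, ‖M i j‖ ≤ ∑ i, ∑ j, ‖M i j‖ :=
      Finset.single_le_sum (f := fun i => ∑ j, ‖M i j‖) (fun _ _ => by positivity)
        (Finset.mem_univ i)
    filter_upwards [ae_norm_le_norm_top (M i j)] with ξ hξ
    linarith
  have hmeas : AEStronglyMeasurable (fun ξ => M.map fun f => f ξ) μ :=
    (aemeasurable_pi_iff.2 fun i => aemeasurable_pi_iff.2 fun j =>
      (Lp.aestronglyMeasurable (M i j)).aemeasurable).aestronglyMeasurable
  have hinv : ∀ i j, MemLp (fun ξ => (M.map fun f => f ξ)⁻¹ i j) ∞ μ := by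
    intro i j
    refine memLp_top_of_bound (C := c⁻¹ * ((Fintype.card ι).factorial * K ^ Fintype.card ι)) ?_ ?_
    · have e : ∀ ξ, (M.map fun f => f ξ)⁻¹ i j
          = ((M.map fun f => f ξ).det)⁻¹ * (M.map fun f => f ξ).adjugate i j := by
        intro ξ
        simp [Matrix.inv_def]
      simp_rw [e]
      have hdet : AEStronglyMeasurable (fun ξ => (M.map fun f => f ξ).det) μ :=
        (continuous_id.matrix_det (n := ι) (R := ℂ)).comp_aestronglyMeasurable hmeas
      have hadj : AEStronglyMeasurable (fun ξ => (M.map fun f => f ξ).adjugate i j) μ :=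
        ((continuous_id.matrix_adjugate (n := ι) (R := ℂ)).matrix_elem i
          j).comp_aestronglyMeasurable hmeas
      exact hdet.aemeasurable.inv.aestronglyMeasurable.mul hadj
    · filter_upwards [hc, hK] with ξ h1 h2
      rw [Matrix.inv_def, Matrix.smul_apply, smul_eq_mul, norm_mul, Ring.inverse_eq_inv',
        norm_inv, Matrix.adjugate_apply]
      gcongr
      refine norm_det_le _ fun k l => ?_
      rw [Matrix.updateRow_apply]
      split_ifs
      · refine le_trans ?_ hK1
        rw [Pi.single_apply]
        split_ifs <;> simp
      · exact h2 k l
  let B : Matrix ι ι (Lp ℂ ∞ μ) := Matrix.of fun i j => (hinv i j).toLp _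
  have hB : ∀ᵐ ξ ∂μ, (B.map fun f => f ξ) = (M.map fun f => f ξ)⁻¹ ∧
      IsUnit (M.map fun f => f ξ).det := by
    filter_upwards [hc, ae_all_iff.2 fun i => ae_all_iff.2 fun j => (hinv i j).coeFn_toLp]
      with ξ h1 h2
    refine ⟨Matrix.ext h2, isUnit_iff_ne_zero.2 fun h0 => ?_⟩
    rw [h0, norm_zero] at h1
    linarith
  refine Function.bijective_iff_has_inverse.2 ⟨mulMatrix B, fun F => ?_, fun F => ?_⟩
  · refine mulMatrix_mulMatrix_of_ae ?_ F
    filter_upwards [hB] with ξ h1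
    rw [h1.1, Matrix.nonsing_inv_mul _ h1.2]
  · refine mulMatrix_mulMatrix_of_ae ?_ F
    filter_upwards [hB] with ξ h1
    rw [h1.1, Matrix.mul_nonsing_inv _ h1.2]

/-- If `M` acts bijectively, the solutions `F j` of `M F j = e j` form the columns of `M⁻¹`.
Cutting off by indicator functions, boundedness of the inverse operator bounds them almost
everywhere, so that `det M⁻¹` is bounded. -/
lemma essInf_det_pos_of_bijective [IsFiniteMeasure μ] (M : Matrix ι ι (Lp ℂ ∞ μ))
    (h : Function.Bijective (mulMatrix M)) :
    0 < essInf (fun ξ => ‖(M.map fun f => f ξ).det‖ₑ) μ := by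
  let e : (ι → Lp ℂ 2 μ) ≃L[ℂ] (ι → Lp ℂ 2 μ) :=
    ContinuousLinearEquiv.ofBijective (mulMatrix M) (LinearMap.ker_eq_bot.2 h.1)
      (LinearMap.range_eq_top.2 h.2)
  obtain ⟨C, hC0, hC⟩ : ∃ C : ℝ, 0 ≤ C ∧ ∀ F, ‖F‖ ≤ C * ‖mulMatrix M F‖ := by
    refine ⟨‖(e.symm : (ι → Lp ℂ 2 μ) →L[ℂ] (ι → Lp ℂ 2 μ))‖, norm_nonneg _, fun F => ?_⟩
    have := (e.symm : (ι → Lp ℂ 2 μ) →L[ℂ] (ι → Lp ℂ 2 μ)).le_opNorm (mulMatrix M F)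
    have h1 : e.symm (mulMatrix M F) = F := e.symm_apply_apply F
    simpa [h1] using this
  choose F hF using fun j => h.2 fun i =>
    if i = j then indicatorConstLp 2 MeasurableSet.univ (measure_ne_top μ _) (1 : ℂ) else 0
  have hzero : ∀ᵐ ξ ∂μ, (0 : Lp ℂ 2 μ) ξ = 0 := Lp.coeFn_zero ℂ 2 μ
  have hone : ∀ᵐ ξ ∂μ,
      indicatorConstLp 2 MeasurableSet.univ (measure_ne_top μ _) (1 : ℂ) ξ = 1 := by
    filter_upwards [indicatorConstLp_coeFn (p := 2) (hs := MeasurableSet.univ)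
      (hμs := measure_ne_top μ _) (c := (1 : ℂ))] with ξ h
    rw [h, Set.indicator_of_mem (Set.mem_univ ξ)]
  have hcol : ∀ᵐ ξ ∂μ, ∀ j, (M.map fun f => f ξ).mulVec (fun i => F j i ξ) = Pi.single j 1 := by
    refine ae_all_iff.2 fun j => ?_
    filter_upwards [coeFn_mulMatrix M (F j), hzero, hone] with ξ h1 h2 h3
    rw [← h1, hF]
    ext i
    by_cases hij : i = j
    · subst hij
      beta_reduce
      rw [if_pos rfl, h3, Pi.single_eq_same]
    · beta_reduce
      rw [if_neg hij, h2, Pi.single_eq_of_ne hij]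
  have hbound : ∀ᵐ ξ ∂μ, ∀ i j, ‖F j i ξ‖ ≤ C + 1 := by
    refine ae_all_iff.2 fun i => ae_all_iff.2 fun j => ?_
    -- On the exceptional set `E`, the cut-off of `F j` would have norm at least
    -- `(C + 1) ‖1_E‖`, whereas its image
    -- under `M` has norm `‖1_E‖`; this forces `‖1_E‖ = 0`.
    let E : Set α := {ξ | C + 1 < ‖F j i ξ‖}
    have hE : MeasurableSet E :=
      measurableSet_lt measurable_const (Lp.stronglyMeasurable (F j i)).norm.measurable
    let u : Lp ℂ 2 μ := indicatorConstLp 2 hE (measure_ne_top μ _) (1 : ℂ)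
    have hu : ∀ᵐ ξ ∂μ, u ξ = E.indicator (fun _ => 1) ξ := indicatorConstLp_coeFn
    let F' : ι → Lp ℂ 2 μ := fun k => ((Lp.memLp (F j k)).indicator hE).toLp _
    have hF' : ∀ᵐ ξ ∂μ, ∀ k, F' k ξ = E.indicator (F j k) ξ :=
      ae_all_iff.2 fun k => MemLp.coeFn_toLp _
    have himg : mulMatrix M F' = fun k => if k = j then u else 0 := by
      funext k
      refine Lp.ext ?_
      filter_upwards [coeFn_mulMatrix M F', hF', hcol, hu, hzero]
        with ξ h1 h2 h3 h4 h5
      rw [congrFun h1 k]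
      simp only [h2]
      by_cases hξ : ξ ∈ E
      · simp only [Set.indicator_of_mem hξ]
        rw [h3 j]
        by_cases hkj : k = j
        · subst hkj
          simp [h4, hξ]
        · rw [if_neg hkj, h5, Pi.single_eq_of_ne hkj]
      · simp only [Set.indicator_of_notMem hξ]
        rw [show (fun _ : ι => (0 : ℂ)) = 0 from rfl, Matrix.mulVec_zero]
        by_cases hkj : k = j
        · simp [hkj, h4, hξ]
        · rw [if_neg hkj, h5, Pi.zero_apply]
    have h1 : ‖F' i‖ ≤ C * ‖u‖ := by
      refine (norm_le_pi_norm F' i).trans ((hC F').trans ?_)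
      gcongr
      rw [himg]
      refine (pi_norm_le_iff_of_nonneg (norm_nonneg _)).2 fun k => ?_
      split_ifs <;> simp
    have h2 : (C + 1) * ‖u‖ ≤ ‖F' i‖ := by
      have h3 : ‖((C + 1 : ℝ) : ℂ) • u‖ ≤ ‖F' i‖ := by
        refine Lp.norm_le_norm_of_ae_le ?_
        filter_upwards [hF', hu, Lp.coeFn_smul ((C + 1 : ℝ) : ℂ) u] with ξ h3 h4 h5
        rw [h5, Pi.smul_apply, h4, h3]
        by_cases hξ : ξ ∈ E
        · simp only [Set.indicator_of_mem hξ, smul_eq_mul, mul_one, Complex.norm_real,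
            Real.norm_eq_abs, abs_of_nonneg (by linarith : (0 : ℝ) ≤ C + 1)]
          exact le_of_lt hξ
        · simp [hξ]
      rwa [norm_smul, Complex.norm_real, Real.norm_eq_abs,
        abs_of_nonneg (by linarith : (0 : ℝ) ≤ C + 1)] at h3
    have h0 : u = 0 := norm_le_zero_iff.1 (by linarith)
    have h3 : ∀ᵐ ξ ∂μ, ξ ∉ E := by
      filter_upwards [hu, hzero] with ξ h4 h5 hξ
      rw [h0, h5] at h4
      simp [hξ] at h4
    filter_upwards [h3] with ξ hξ
    exact not_lt.1 hξ
  set K : ℝ := (Fintype.card ι).factorial * (C + 1) ^ Fintype.card ι with hKdef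
  have hK : 0 < K := by positivity
  refine lt_of_lt_of_le (ENNReal.ofReal_pos.2 (inv_pos.2 hK)) (le_essInf_of_ae_le _ ?_)
  filter_upwards [hcol, hbound] with ξ h1 h2
  have h3 : (M.map fun f => f ξ) * (Matrix.of fun i j => F j i ξ) = 1 := by
    ext i j
    have := congrFun (h1 j) i
    simpa [Matrix.mul_apply, Matrix.mulVec, dotProduct, Matrix.one_apply, Pi.single_apply]
      using this
  have h4 : ‖(M.map fun f => f ξ).det‖ * ‖(Matrix.of fun i j => F j i ξ).det‖ = 1 := by
    rw [← norm_mul, ← Matrix.det_mul, h3, Matrix.det_one, norm_one]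
  have h5 : ‖(Matrix.of fun i j => F j i ξ).det‖ ≤ K := norm_det_le _ h2
  rw [← ofReal_norm]
  refine ENNReal.ofReal_le_ofReal ?_
  rw [inv_le_iff_one_le_mul₀ hK, ← h4]
  gcongr

end Multiplication

/-! ### The Fourier transform -/

section Fourier

variable {G : Type*} [AddCommGroup G] [TopologicalSpace G] [DiscreteTopology G]

omit [DiscreteTopology G] in
lemma conjChar_zero : conjChar (0 : G) = 1 := by
  ext ξ
  simp [conjChar]

omit [DiscreteTopology G] in
lemma conjChar_add (g h : G) : conjChar (g + h) = conjChar g * conjChar h := by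
  ext ξ
  simp [conjChar]

omit [DiscreteTopology G] in
lemma conjChar_neg (g : G) : conjChar (-g) = star (conjChar g) := by
  ext ξ
  simp [conjChar, ← Circle.coe_inv_eq_conj]

/-- By the Stone–Weierstrass theorem, trigonometric polynomials are dense in `C(Ĝ)`. -/
lemma span_conjChar_closure_eq_top :
    (Submodule.span ℂ (Set.range (conjChar : G → C(Dual G, ℂ)))).topologicalClosure = ⊤ := by
  let B : StarSubalgebra ℂ C(Dual G, ℂ) :=
    { toSubalgebra := Algebra.adjoin ℂ (Set.range conjChar)
      star_mem' := by
        change Algebra.adjoin ℂ (Set.range conjChar) ≤ star (Algebra.adjoin ℂ (Set.range conjChar))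
        refine Algebra.adjoin_le ?_
        rintro - ⟨g, rfl⟩
        exact Algebra.subset_adjoin ⟨-g, conjChar_neg g⟩ }
  have hB : Subalgebra.toSubmodule B.toSubalgebra = Submodule.span ℂ (Set.range conjChar) := by
    apply Algebra.adjoin_eq_span_of_subset
    refine Set.Subset.trans ?_ Submodule.subset_span
    intro x hx
    refine Submonoid.closure_induction (fun _ => id) ⟨0, conjChar_zero⟩ ?_ hx
    rintro - - - - ⟨m, rfl⟩ ⟨n, rfl⟩
    exact ⟨m + n, conjChar_add m n⟩
  have hsep : B.SeparatesPoints := by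
    intro x y hxy
    obtain ⟨g, hg⟩ : ∃ g : G, x (Multiplicative.ofAdd g) ≠ y (Multiplicative.ofAdd g) := by
      by_contra! hc
      exact hxy (PontryaginDual.ext fun a => hc a.toAdd)
    refine ⟨_, ⟨conjChar g, Algebra.subset_adjoin ⟨g, rfl⟩, rfl⟩, fun he => hg ?_⟩
    exact Circle.ext (star_injective he)
  rw [← hB]
  exact congr_arg (Subalgebra.toSubmodule <| StarSubalgebra.toSubalgebra ·)
    (ContinuousMap.starSubalgebra_topologicalClosure_eq_top_of_separatesPoints B hsep)

instance dualHaar_regular : (dualHaar G).Regular := by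
  unfold dualHaar; infer_instance

lemma span_conjCharL2_closure_eq_top :
    (Submodule.span ℂ (Set.range (conjCharL2 : G → Lp ℂ 2 (dualHaar G)))).topologicalClosure
      = ⊤ := by
  have h := (ContinuousMap.toLp_denseRange (p := 2) ℂ (dualHaar G) ℂ
    (by norm_num)).topologicalClosure_map_submodule span_conjChar_closure_eq_top
  rw [← h, Submodule.map_span, ← Set.range_comp]
  rfl

/-- The conjugate characters form a Hilbert basis of `L²(Ĝ)`. -/
def charBasis : HilbertBasis G ℂ (Lp ℂ 2 (dualHaar G)) :=
  HilbertBasis.mk orthonormal_conjCharL2 span_conjCharL2_closure_eq_top.ge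

@[simp] lemma charBasis_apply (g : G) : charBasis g = conjCharL2 g := by
  simp [charBasis]

/-- The Fourier transform `ℓ²(G) → L²(Ĝ)` is a unitary operator. -/
lemma charBasis_repr_symm (x : ell2 G) : charBasis.repr.symm x = fourier x := by
  have h := charBasis.hasSum_repr_symm x
  simp only [charBasis_apply] at h
  exact h.unique (hasSum_fourier x)

/-- Multiplication by a bounded `â` on the Fourier side is convolution with `a`. -/
lemma repr_mul_fourier (a x : ell2 G) (ha : MemLp (fourier a) ∞ (dualHaar G)) (g : G) :
    charBasis.repr ((ContinuousLinearMap.mul ℂ ℂ).holder 2 (ha.toLp _) (fourier x)) g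
      = conv a x g := by
  let L := (ContinuousLinearMap.mul ℂ ℂ).holderL (dualHaar G) ∞ 2 2 (ha.toLp _)
  have h1 : HasSum (fun g' => x g' • charBasis.repr (L (conjCharL2 g')) g)
      (charBasis.repr (L (fourier x)) g) := by
    have := (((lp.evalCLM ℂ (fun _ : G => ℂ) g (p := 2)).comp
      (charBasis.repr.toContinuousLinearEquiv.toContinuousLinearMap.comp L)).hasSum
        (hasSum_fourier x))
    exact this.congr_fun fun g' => (map_smul ((lp.evalCLM ℂ (fun _ : G => ℂ) g (p := 2)).comp
      (charBasis.repr.toContinuousLinearEquiv.toContinuousLinearMap.comp L)) _ _).symm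
  have h2 : ∀ g', charBasis.repr (L (conjCharL2 g')) g = a (g - g') := by
    intro g'
    -- Both sides are the integral of `â(ξ) ⟨g - g', ξ⟩`.
    have h3 : charBasis.repr (fourier a) (g - g') = a (g - g') := by
      rw [← charBasis_repr_symm, LinearIsometryEquiv.apply_symm_apply]
    rw [← h3, HilbertBasis.repr_apply_apply, HilbertBasis.repr_apply_apply, L2.inner_def,
      L2.inner_def]
    refine integral_congr_ae ?_
    have e1 := (ContinuousLinearMap.mul ℂ ℂ).coeFn_holder (r := 2) (ha.toLp _) (conjCharL2 g')
    have e2 := fun g : G => ContinuousMap.coeFn_toLp (p := 2) (𝕜 := ℂ) (dualHaar G) (conjChar g)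
    filter_upwards [e1, ha.coeFn_toLp, e2 g, e2 g', e2 (g - g')] with ξ k1 k2 k3 k4 k5
    simp only [L, ContinuousLinearMap.holderL_apply_apply, charBasis_apply]
    rw [k1, k2]
    simp only [conjCharL2]
    rw [k3, k4, k5, sub_eq_add_neg, conjChar_add, conjChar_neg]
    simp
    ring
  refine h1.tsum_eq.symm.trans (tsum_congr fun g' => ?_)
  rw [h2, smul_eq_mul, mul_comm]

end Fourier

/-! ### The sampling operator -/

section SamplingOperator

variable {G : Type*} [AddCommGroup G] [TopologicalSpace G] [DiscreteTopology G] {N : ℕ}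

/-- The transfer matrix as a matrix over `L^∞(Ĝ)`. -/
def transferLp (A : Matrix (Fin N) (Fin N) (ell2 G))
    (hA : ∀ m n, MemLp (fourier (A m n)) ∞ (dualHaar G)) :
    Matrix (Fin N) (Fin N) (Lp ℂ ∞ (dualHaar G)) :=
  Matrix.of fun m n => (hA m n).toLp _

lemma essInf_det_transferLp (A : Matrix (Fin N) (Fin N) (ell2 G))
    (hA : ∀ m n, MemLp (fourier (A m n)) ∞ (dualHaar G)) :
    essInf (fun ξ => ‖((transferLp A hA).map fun f => f ξ).det‖ₑ) (dualHaar G)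
      = essInf (fun ξ => ‖(transferMatrix A ξ).det‖ₑ) (dualHaar G) := by
  refine essInf_congr_ae ?_
  filter_upwards [ae_all_iff.2 fun m => ae_all_iff.2 fun n => (hA m n).coeFn_toLp] with ξ h
  have : ((transferLp A hA).map fun f => f ξ) = transferMatrix A ξ := Matrix.ext h
  rw [this]

/-- The Fourier transform of each of the `N` slices. -/
def fourierSlices : ell2 (G × Fin N) ≃L[ℂ] (Fin N → Lp ℂ 2 (dualHaar G)) :=
  slices.trans (ContinuousLinearEquiv.piCongrRight fun _ =>
    charBasis.repr.symm.toContinuousLinearEquiv)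

/-- The operator `x ↦ A * x` on `ℓ²(G × Fin N)`, defined on the Fourier side as multiplication
by the transfer matrix. -/
def convOp (A : Matrix (Fin N) (Fin N) (ell2 G))
    (hA : ∀ m n, MemLp (fourier (A m n)) ∞ (dualHaar G)) :
    ell2 (G × Fin N) →L[ℂ] ell2 (G × Fin N) :=
  fourierSlices.symm.toContinuousLinearMap.comp
    ((mulMatrix (transferLp A hA)).comp fourierSlices.toContinuousLinearMap)

/-- On the group side, `convOp` is given by the convolution series that define the samples. -/
lemma convOp_apply (A : Matrix (Fin N) (Fin N) (ell2 G))
    (hA : ∀ m n, MemLp (fourier (A m n)) ∞ (dualHaar G)) (x : ell2 (G × Fin N))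
    (p : G × Fin N) :
    convOp A hA x p = ∑ n, conv (A p.2 n) (fun g => x (g, n)) p.1 := by
  have h1 : convOp A hA x p
      = charBasis.repr (mulMatrix (transferLp A hA) (fourierSlices x) p.2) p.1 := rfl
  have h2 : mulMatrix (transferLp A hA) (fourierSlices x) p.2
      = ∑ n, (ContinuousLinearMap.mul ℂ ℂ).holder 2 ((hA p.2 n).toLp _)
        (fourier (slices x n)) := by
    simp [mulMatrix, fourierSlices, transferLp, charBasis_repr_symm]
  rw [h1, h2, map_sum, lp.coeFn_sum, Finset.sum_apply]
  exact Finset.sum_congr rfl fun n _ => repr_mul_fourier _ _ (hA p.2 n) p.1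

/-- The convolution operator is invertible exactly when `|det Â|` is bounded below. -/
lemma bijective_convOp_iff (A : Matrix (Fin N) (Fin N) (ell2 G))
    (hA : ∀ m n, MemLp (fourier (A m n)) ∞ (dualHaar G)) :
    Function.Bijective (convOp A hA) ↔
      0 < essInf (fun ξ => ‖(transferMatrix A ξ).det‖ₑ) (dualHaar G) := by
  rw [← essInf_det_transferLp A hA]
  have h : ⇑(convOp A hA) = fourierSlices.symm ∘ mulMatrix (transferLp A hA) ∘ fourierSlices := rfl
  rw [h, Function.Bijective.of_comp_iff' fourierSlices.symm.bijective,
    Function.Bijective.of_comp_iff _ fourierSlices.bijective]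
  exact ⟨essInf_det_pos_of_bijective _, bijective_mulMatrix_of_det _⟩

/-- The permutation `(h, n) ↦ (h - g, n)`, so that `reindex (shift g)` is translation by `g`. -/
def shift (g : G) : G × Fin N ≃ G × Fin N := (Equiv.subRight g).prodCongr (Equiv.refl _)

lemma convOp_translate (A : Matrix (Fin N) (Fin N) (ell2 G))
    (hA : ∀ m n, MemLp (fourier (A m n)) ∞ (dualHaar G)) (g : G) (x : ell2 (G × Fin N)) :
    convOp A hA (reindex (shift g) x) = reindex (shift g) (convOp A hA x) := by
  refine lp.ext (funext fun p => ?_)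
  rw [reindex_apply, convOp_apply, convOp_apply]
  refine Finset.sum_congr rfl fun n _ => ?_
  refine Eq.trans (tsum_congr fun h => ?_) ((Equiv.subRight g).tsum_eq
    fun h => A p.2 n ((shift g p).1 - h) * x (h, n))
  simp [shift]

end SamplingOperator

/-! ### Sampling formulas and the inverse of the sampling operator -/

section Sampling

variable {G : Type*} [AddCommGroup G] {H : Type*} [NormedAddCommGroup H] [InnerProductSpace ℂ H]
  {U : Multiplicative G →* (H ≃ₗᵢ[ℂ] H)} {N : ℕ} {φ : Fin N → H}

lemma synthesis_stdVec {ι : Type*} {f : ι → H} (hf : IsRieszSequence f) (i : ι) :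
    (hf.synthesis (stdVec i) : H) = f i :=
  hf.choose_spec i

/-- The synthesis operator intertwines translations with the representation. -/
lemma synthesis_translate (hφ : IsRieszSequence (orbit U φ)) (g : G) (x : ell2 (G × Fin N)) :
    (hφ.synthesis (reindex (shift g) x) : H)
      = U (Multiplicative.ofAdd g) (hφ.synthesis x : H) := by
  classical
  let T : ell2 (G × Fin N) →L[ℂ] H := (VΦ U φ).subtypeL.comp
    (hφ.synthesis : ell2 (G × Fin N) →L[ℂ] VΦ U φ)
  have h : T.comp (reindex (shift g)) = ((U (Multiplicative.ofAdd g)).toContinuousLinearEquiv :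
      H →L[ℂ] H).comp T := by
    refine clm_ext_stdVec fun p => ?_
    have hp : p = shift g (p.1 + g, p.2) := by simp [shift]
    have h1 : reindex (shift g) (stdVec p) = stdVec (p.1 + g, p.2) := by
      conv_lhs => rw [hp]
      exact reindex_stdVec _ _
    show (hφ.synthesis (reindex (shift g) (stdVec p)) : H)
      = U (Multiplicative.ofAdd g) (hφ.synthesis (stdVec p) : H)
    rw [h1, synthesis_stdVec, synthesis_stdVec, orbit, orbit, add_comm, ofAdd_add, map_mul]
    rfl
  exact DFunLike.congr_fun h x

variable [TopologicalSpace G] [DiscreteTopology G]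

lemma sample_eq_convOp (hφ : IsRieszSequence (orbit U φ)) (A : Matrix (Fin N) (Fin N) (ell2 G))
    (hA : ∀ m n, MemLp (fourier (A m n)) ∞ (dualHaar G)) (m : Fin N) (f : VΦ U φ) (g : G) :
    sample hφ A m f g = convOp A hA (hφ.synthesis.symm f) (g, m) :=
  (convOp_apply A hA _ (g, m)).symm

/-- For a Riesz basis, with isomorphism `R`, the sampling formula says that `R` inverts the
analysis operator `f ↦ (L_m f(g))`. -/
lemma samplingFormula_iff (hφ : IsRieszSequence (orbit U φ))
    (A : Matrix (Fin N) (Fin N) (ell2 G))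
    (hA : ∀ m n, MemLp (fourier (A m n)) ∞ (dualHaar G)) (S : Fin N → VΦ U φ)
    (R : ell2 (G × Fin N) ≃L[ℂ] VΦ U φ)
    (hR : ∀ p, (R (stdVec p) : H) = orbit U (fun n => (S n : H)) p) :
    SamplingFormula hφ A S ↔ ∀ x, R (convOp A hA x) = hφ.synthesis x := by
  have key : ∀ f : VΦ U φ, HasSum
      (fun p : G × Fin N => sample hφ A p.2 f p.1 • U (Multiplicative.ofAdd p.1) (S p.2 : H))
      (R (convOp A hA (hφ.synthesis.symm f)) : H) := by
    intro f
    refine (hasSum_clm_stdVec ((VΦ U φ).subtypeL.comp (R : ell2 (G × Fin N) →L[ℂ] VΦ U φ))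
      (convOp A hA (hφ.synthesis.symm f))).congr_fun fun p => ?_
    rw [sample_eq_convOp hφ A hA]
    exact congrArg (_ • ·) (hR p).symm
  constructor
  · intro h x
    have := (key (hφ.synthesis x)).unique (h (hφ.synthesis x))
    rw [ContinuousLinearEquiv.symm_apply_apply] at this
    exact Subtype.ext this
  · intro h f
    have := key f
    rwa [h, ContinuousLinearEquiv.apply_symm_apply] at this

omit [TopologicalSpace G] [DiscreteTopology G] in
lemma orbit_zero (S : Fin N → H) (n : Fin N) : orbit U S (0, n) = S n := by
  simp [orbit]

end Sampling

end

end USampling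

theorem mainTheorem2
    {G : Type*} [AddCommGroup G] [DecidableEq G] [Countable G] [TopologicalSpace G] [DiscreteTopology G]
    {H : Type*} [NormedAddCommGroup H] [InnerProductSpace ℂ H] [CompleteSpace H]
    [TopologicalSpace.SeparableSpace H]
    (U : Multiplicative G →* (H ≃ₗᵢ[ℂ] H)) {N : ℕ} (φ : Fin N → H)
    (hφ : USampling.IsRieszSequence (USampling.orbit U φ))
    (A : Matrix (Fin N) (Fin N) (USampling.ell2 G))
    (hA : ∀ m n, MemLp (USampling.fourier (A m n)) ∞ (USampling.dualHaar G)) :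
    (0 < essInf (fun ξ => ‖(USampling.transferMatrix A ξ).det‖ₑ) (USampling.dualHaar G) ↔
      ∃! S : Fin N → USampling.VΦ U φ,
        USampling.IsRieszBasis (USampling.orbit U (fun n => (S n : H))) (USampling.VΦ U φ) ∧
        USampling.SamplingFormula hφ A S) ∧
    ∀ S : Fin N → USampling.VΦ U φ,
      USampling.IsRieszBasis (USampling.orbit U (fun n => (S n : H))) (USampling.VΦ U φ) →
      USampling.SamplingFormula hφ A S →
      ∀ (n n' : Fin N) (g : G),
        USampling.sample hφ A n (S n') g = if n = n' ∧ g = 0 then 1 else 0 := by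
  classical
  open USampling in
  refine ⟨⟨fun hdet => ?_, ?_⟩, ?_⟩
  · have hbij := (bijective_convOp_iff A hA).2 hdet
    let Λ : ell2 (G × Fin N) ≃L[ℂ] ell2 (G × Fin N) :=
      ContinuousLinearEquiv.ofBijective (convOp A hA) (LinearMap.ker_eq_bot.2 hbij.1)
        (LinearMap.range_eq_top.2 hbij.2)
    have hΛ : ∀ x, Λ x = convOp A hA x := fun _ => rfl
    let R : ell2 (G × Fin N) ≃L[ℂ] VΦ U φ := Λ.symm.trans hφ.synthesis
    let S : Fin N → VΦ U φ := fun n => R (stdVec (0, n))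
    have hR : ∀ p, (R (stdVec p) : H) = orbit U (fun n => (S n : H)) p := by
      rintro ⟨g, n⟩
      have h1 : stdVec (g, n) = reindex (shift g) (stdVec ((0 : G), n)) := by
        rw [← reindex_stdVec (shift g) (g, n)]
        simp [shift]
      -- `Λ⁻¹` commutes with translations because `Λ` does.
      have h2 : Λ.symm (stdVec (g, n))
          = reindex (shift g) (Λ.symm (stdVec ((0 : G), n))) := by
        rw [ContinuousLinearEquiv.symm_apply_eq, hΛ, convOp_translate, ← hΛ,
          ContinuousLinearEquiv.apply_symm_apply, h1]
      change (hφ.synthesis (Λ.symm (stdVec (g, n))) : H) = _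
      rw [h2, synthesis_translate]
      rfl
    refine ⟨S, ⟨⟨R, hR⟩, (samplingFormula_iff hφ A hA S R hR).2 fun x => ?_⟩, ?_⟩
    · rw [← hΛ]
      exact congrArg _ (Λ.symm_apply_apply x)
    · rintro S' ⟨⟨R', hR'⟩, hS'⟩
      -- `R' Λ = T` forces `R' = R`.
      have hR'' : ∀ p, (R' (stdVec p) : H) = orbit U (fun n => (S' n : H)) p := hR'
      have h1 := (samplingFormula_iff hφ A hA S' R' hR'').1 hS'
      funext n
      refine Subtype.ext ?_
      have h2 := hR'' (0, n)
      rw [orbit_zero] at h2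
      rw [← h2]
      refine congrArg _ ?_
      change _ = hφ.synthesis (Λ.symm (stdVec (0, n)))
      rw [← h1, ← hΛ, ContinuousLinearEquiv.apply_symm_apply]
  · rintro ⟨S, ⟨⟨R, hR⟩, hS⟩, -⟩
    have h1 := (samplingFormula_iff hφ A hA S R hR).1 hS
    -- `R Λ = T` with `R` and `T` bijective.
    rw [← bijective_convOp_iff A hA, ← Function.Bijective.of_comp_iff' R.bijective]
    convert hφ.synthesis.bijective using 1
    exact funext h1
  · rintro S ⟨R, hR⟩ hS n n' g
    have hR' : ∀ p, (R (stdVec p) : H) = orbit U (fun n => (S n : H)) p := hR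
    have h1 := (samplingFormula_iff hφ A hA S R hR').1 hS
    have h2 : S n' = R (stdVec (0, n')) :=
      Subtype.ext ((hR' (0, n')).trans (orbit_zero _ _)).symm
    have h3 : convOp A hA (hφ.synthesis.symm (S n')) = stdVec (0, n') := by
      apply R.injective
      rw [h1, ContinuousLinearEquiv.apply_symm_apply, h2]
    rw [sample_eq_convOp hφ A hA, h3, stdVec_apply]
    simp [Prod.ext_iff, and_comm]
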